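/- Let the cube be $[0,1]^3\subset\mathbb R^3$, with its six faces, and let the cube graph be the graph formed by its eight vertices and twelve edges. A collection of unit squares in the plane is said to be \emph{joined along edges} if, whenever two different squares of the collection intersect, their intersection is either precisely an edge of both squares, or precisely a vertex $p$ of both squares, where in the latter case some third square of the collection contains $p$ and shares an edge with each of the two (as at the corner of an L-shape). The collection is \emph{connected} if the boundary of the region that it covers has a single connected component. An \emph{unfolding} of the cube is a connected planar arrangement of six unit squares, joined along edges, that folds up into the cube; that is, there is a map $f$ from the union of the squares to $\mathbb R^3$ which is an isometry on each square and maps the six squares one-to-one onto the six faces of the cube. The \emph{edge-cutting pattern} of the unfolding (with folding map $f$) consists of the edges $e$ of the cube that have been cut, that is, those for which there are no two different squares $Q,Q'$ of the arrangement with $e\subseteq f(Q\cap Q')$. Proposition. Let $T$ be a subgraph of the cube graph whose edges are precisely the edge-cutting pattern of some unfolding of the cube. Then $T$ is a spanning tree of the cube graph: it contains all eight vertices, is connected, and has no circuits. -/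

import Mathlib

namespace CubeUnfolding

/-- The Euclidean plane. -/
abbrev Plane := EuclideanSpace ℝ (Fin 2)

/-- Euclidean three-space, which contains the cube. -/
abbrev Space := EuclideanSpace ℝ (Fin 3)

/-! ### The cube and its graph -/

/-- The vertices of the cube `[0,1]³`, given by their coordinates (`true` for `1`, `false` for
`0`). -/
abbrev CubeVertex := Fin 3 → Bool

/-- The position of a vertex of the cube in three-space. -/
noncomputable def vertexPos (v : CubeVertex) : Space :=
  WithLp.toLp 2 (fun i => if v i then 1 else 0)

/-- The cube graph: two vertices are adjacent when they differ in exactly one coordinate. -/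
def cubeGraph : SimpleGraph CubeVertex where
  Adj u v := hammingDist u v = 1
  symm := ⟨fun u v h => by rw [hammingDist_comm]; exact h⟩
  loopless := ⟨fun u h => by simp at h⟩

/-- The edge of the cube with end points `u` and `v`, as a set of points. -/
noncomputable def cubeEdge (u v : CubeVertex) : Set Space :=
  segment ℝ (vertexPos u) (vertexPos v)

/-- `F` is one of the six faces of the cube `[0,1]³`. -/
def IsCubeFace (F : Set Space) : Prop :=
  ∃ (i : Fin 3) (c : ℝ), (c = 0 ∨ c = 1) ∧
    F = {x | (∀ j, x j ∈ Set.Icc (0 : ℝ) 1) ∧ x i = c}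

/-! ### Collections of squares in the plane -/

/-- The square `[0,1]²`. -/
def stdSquare : Set Plane := {x | ∀ i, x i ∈ Set.Icc (0 : ℝ) 1}

/-- `Q` is a (closed, filled) square of side `1`, in any position in the plane. -/
def IsSquare (Q : Set Plane) : Prop :=
  ∃ σ : Plane ≃ᵢ Plane, Q = σ '' stdSquare

/-- `s` is one of the four edges of the square `Q`. The symmetries of `[0,1]²` carry its bottom
edge to each of its edges, so all of them are obtained by varying `σ`. -/
def IsEdgeOf (s Q : Set Plane) : Prop :=
  ∃ σ : Plane ≃ᵢ Plane, Q = σ '' stdSquare ∧ s = σ '' {x ∈ stdSquare | x 1 = 0}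

/-- `p` is one of the four vertices of the square `Q`. -/
def IsVertexOf (p : Plane) (Q : Set Plane) : Prop :=
  ∃ σ : Plane ≃ᵢ Plane, Q = σ '' stdSquare ∧ p = σ 0

/-- The intersection of `Q` and `Q'` is precisely an edge of both. -/
def ShareEdge (Q Q' : Set Plane) : Prop :=
  IsEdgeOf (Q ∩ Q') Q ∧ IsEdgeOf (Q ∩ Q') Q'

/-- The squares of the collection are joined along edges: two different squares that intersect
have precisely an edge of both in common, except that two squares may have just a vertex of both
in common when they are consecutive neighbours, around that vertex, of a third square of the
collection with which each of them shares an edge (as in an L-shape of three squares). -/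
def JoinedAlongEdges (𝒬 : Set (Set Plane)) : Prop :=
  ∀ Q ∈ 𝒬, ∀ Q' ∈ 𝒬, Q ≠ Q' → (Q ∩ Q').Nonempty →
    ShareEdge Q Q' ∨
    ∃ p, Q ∩ Q' = {p} ∧ IsVertexOf p Q ∧ IsVertexOf p Q' ∧
      ∃ R ∈ 𝒬, p ∈ R ∧ ShareEdge Q R ∧ ShareEdge R Q'

/-- The collection is connected: the boundary of the planar region covered by the squares has
a single component. -/
def IsConnectedCollection (𝒬 : Set (Set Plane)) : Prop :=
  IsConnected (frontier (⋃₀ 𝒬))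

/-! ### Unfoldings and cutting patterns -/

/-- The map `f` (only its values on the squares matter) folds the squares of `𝒬` up into the
cube: it does not distort any of the squares, and it lays them onto the faces of the cube, exactly
one square onto each face. Squares with a common edge stay attached along it, since `f` is a
function on the union of the squares. -/
def FoldsUp (𝒬 : Set (Set Plane)) (f : Plane → Space) : Prop :=
  (∀ Q ∈ 𝒬, ∀ x ∈ Q, ∀ y ∈ Q, dist (f x) (f y) = dist x y) ∧
  Set.BijOn (fun Q => f '' Q) 𝒬 {F | IsCubeFace F}

/-- `𝒬` is an unfolding of the cube and `f` folds it up: a connected planar arrangement of six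
squares, joined along edges, that `f` folds up into the cube. -/
structure IsUnfolding (𝒬 : Set (Set Plane)) (f : Plane → Space) : Prop where
  isSquare : ∀ Q ∈ 𝒬, IsSquare Q
  six : 𝒬.ncard = 6
  joined : JoinedAlongEdges 𝒬
  connected : IsConnectedCollection 𝒬
  folds : FoldsUp 𝒬 f

/-- In the unfolding `𝒬`, folded up by `f`, the cube is uncut along the edge `uv`: two of the
squares are still attached to each other along that edge. -/
def IsUncut (𝒬 : Set (Set Plane)) (f : Plane → Space) (u v : CubeVertex) : Prop :=
  ∃ Q ∈ 𝒬, ∃ Q' ∈ 𝒬, Q ≠ Q' ∧ cubeEdge u v ⊆ f '' (Q ∩ Q')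

/-- Cutting the cube along the edges of the subgraph `T` of the cube graph, and along no others,
produces an unfolding. -/
def ProducesUnfolding (T : cubeGraph.Subgraph) : Prop :=
  ∃ (𝒬 : Set (Set Plane)) (f : Plane → Space), IsUnfolding 𝒬 f ∧
    ∀ u v, T.Adj u v ↔ cubeGraph.Adj u v ∧ ¬ IsUncut 𝒬 f u v

/-- `T` is a spanning tree: it contains all the vertices, is connected and has no circuits. -/
def IsSpanningTree (T : cubeGraph.Subgraph) : Prop :=
  T.IsSpanning ∧ T.Connected ∧ T.coe.IsAcyclic

end CubeUnfolding

namespace CubeUnfolding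

/-! The proof is a count of the twelve edges of the cube. The dual graph joins two of the six faces
when their common edge is uncut. It is connected, because the squares are connected across shared
edges (`eq_univ_of_shareEdge`) and a shared edge folds onto an uncut cube edge
(`FoldsUp.isUncut_of_shareEdge`); so at least five edges are uncut. If the cut edges connect all
eight vertices, at least seven are cut. As 5 + 7 = 12, exactly seven are cut, and a connected graph
with eight vertices and seven edges is a tree (`IsUnfolding.isTree`).

Connectedness of the cut edges is `IsUnfolding.exists_cut_edge`. If every edge leaving a vertex set
`A` were uncut, then each face with such an edge would have at least two, since its boundary is a
closed circuit. All squares lie in one square lattice (`IsUnfolding.exists_lattice`), so these faces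
give at most six cells, each with two neighbours among them. Such cells contain a 2×2 block
(`exists_block`). Its central point would fold to a point of four distinct faces, but no two of
these can be parallel and there are only three directions. -/

/-! ### Faces of the cube and the edges between them -/

/-- The faces of the cube, given by the coordinate that is constant and its value. -/
abbrev CubeFace := Fin 3 × Bool

/-- The set of points of a face of the cube. -/
def CubeFace.points (F : CubeFace) : Set Space :=
  {x | (∀ j, x j ∈ Set.Icc (0 : ℝ) 1) ∧ x F.1 = if F.2 then 1 else 0}

/-- For two faces that are not parallel, the starting point of their common edge, oriented in such
a way that the edges of `F` form a directed circuit. -/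
def edgeStart (F G : CubeFace) : CubeVertex := fun k =>
  if k = F.1 then F.2 else if k = G.1 then G.2 else
    xor (decide (G.1 = F.1 + 1)) (xor F.2 G.2)

lemma isCubeFace_points (F : CubeFace) : IsCubeFace F.points :=
  ⟨F.1, if F.2 then 1 else 0, by split_ifs <;> simp, rfl⟩

lemma IsCubeFace.exists_points {S : Set Space} (h : IsCubeFace S) :
    ∃ F : CubeFace, S = F.points := by
  obtain ⟨i, c, rfl | rfl, rfl⟩ := h
  · exact ⟨(i, false), by simp [CubeFace.points]⟩
  · exact ⟨(i, true), by simp [CubeFace.points]⟩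

lemma vertexPos_mem_points {w : CubeVertex} {F : CubeFace} :
    vertexPos w ∈ F.points ↔ w F.1 = F.2 := by
  have h : ∀ j, (0 : ℝ) ≤ (if w j then 1 else 0) ∧ (if w j then (1 : ℝ) else 0) ≤ 1 := by
    intro j; split_ifs <;> simp
  simp only [CubeFace.points, vertexPos, Set.mem_ofPred_eq, Set.mem_Icc, h, and_self,
    implies_true, true_and]
  cases w F.1 <;> cases F.2 <;> simp

lemma points_injective : Function.Injective CubeFace.points := by
  intro F G h
  have key : ∀ w : CubeVertex, w F.1 = F.2 ↔ w G.1 = G.2 := fun w => by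
    rw [← vertexPos_mem_points, ← vertexPos_mem_points, h]
  clear h
  revert F G
  decide

lemma fst_ne_of_mem_points {F G : CubeFace} (hFG : F ≠ G) {x : Space} (hF : x ∈ F.points)
    (hG : x ∈ G.points) : F.1 ≠ G.1 := by
  obtain ⟨i, a⟩ := F
  obtain ⟨j, b⟩ := G
  rintro ⟨rfl⟩
  have h := hF.2.symm.trans hG.2
  cases a <;> cases b <;> simp_all

lemma cubeGraph_adj_edgeStart {F G : CubeFace} (h : F.1 ≠ G.1) :
    cubeGraph.Adj (edgeStart F G) (edgeStart G F) := by
  change hammingDist _ _ = 1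
  revert F G
  decide

lemma exists_edgeStart_eq {u v : CubeVertex} (h : cubeGraph.Adj u v) :
    ∃ F G : CubeFace, F.1 ≠ G.1 ∧ u = edgeStart F G ∧ v = edgeStart G F := by
  change hammingDist _ _ = 1 at h
  revert u v
  decide

/-- An edge of the cube lies on no third face; this identifies the squares attached along it. -/
lemma eq_or_eq_of_edgeStart {F G H : CubeFace} (h : F.1 ≠ G.1)
    (h₁ : edgeStart F G H.1 = H.2) (h₂ : edgeStart G F H.1 = H.2) : H = F ∨ H = G := by
  revert F G H
  decide

lemma edgeStart_injective {F G F' G' : CubeFace} (h : F.1 ≠ G.1) (h' : F'.1 ≠ G'.1)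
    (h₁ : edgeStart F G = edgeStart F' G') (h₂ : edgeStart G F = edgeStart G' F') :
    F = F' ∧ G = G' := by
  have hF := eq_or_eq_of_edgeStart (H := F) h' (by rw [← h₁]; simp [edgeStart])
    (by rw [← h₂]; simp [edgeStart, h])
  have hG := eq_or_eq_of_edgeStart (H := G) h' (by rw [← h₁]; simp [edgeStart, h.symm])
    (by rw [← h₂]; simp [edgeStart])
  rcases hF with rfl | rfl <;> rcases hG with rfl | rfl
  · exact absurd rfl h
  · exact ⟨rfl, rfl⟩
  · exact absurd h₁ (cubeGraph_adj_edgeStart h).ne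
  · exact absurd rfl h

lemma exists_circuit {F G : CubeFace} (h : F.1 ≠ G.1) : ∃ G₁ G₂ G₃ : CubeFace,
    (G₁ ≠ G ∧ G₂ ≠ G ∧ G₃ ≠ G) ∧ (F.1 ≠ G₁.1 ∧ F.1 ≠ G₂.1 ∧ F.1 ≠ G₃.1) ∧
    edgeStart G F = edgeStart F G₁ ∧ edgeStart G₁ F = edgeStart F G₂ ∧
    edgeStart G₂ F = edgeStart F G₃ ∧ edgeStart G₃ F = edgeStart F G := by
  -- In `Fin 3` the three indices sum to zero, so `-(F.1 + G.1)` is the third coordinate. The sides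
  -- of `F` after `G` are the face through the end of their common edge, the face opposite `G`, and
  -- the face through the start.
  refine ⟨(-(F.1 + G.1), edgeStart G F (-(F.1 + G.1))), (G.1, !G.2),
    (-(F.1 + G.1), edgeStart F G (-(F.1 + G.1))), ?_⟩
  revert F G
  decide

lemma cubeGraph_preconnected : cubeGraph.Preconnected := by
  have step : ∀ {u v : CubeVertex}, hammingDist u v ≤ 1 → cubeGraph.Reachable u v := by
    intro u v h
    rcases Nat.le_one_iff_eq_zero_or_eq_one.1 h with h | h
    · rw [hammingDist_eq_zero.1 h]
    · exact SimpleGraph.Adj.reachable (G := cubeGraph) h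
  intro u v
  have h : ∃ m n : CubeVertex, hammingDist u m ≤ 1 ∧ hammingDist m n ≤ 1 ∧
      hammingDist n v ≤ 1 := by
    revert u v
    decide
  obtain ⟨m, n, h₁, h₂, h₃⟩ := h
  exact (step h₁).trans ((step h₂).trans (step h₃))

/-! ### Isometries of the plane -/

/-- By Mazur–Ulam an isometry is affine; `A` is the image of the origin, and `B`, `C` are the
orthonormal columns of the linear part. -/
lemma isometryEquiv_coord (σ : Plane ≃ᵢ Plane) : ∃ A B C : Fin 2 → ℝ,
    (∀ x i, σ x i = A i + B i * x 0 + C i * x 1) ∧ B 0 ^ 2 + B 1 ^ 2 = 1 ∧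
    C 0 ^ 2 + C 1 ^ 2 = 1 ∧ B 0 * C 0 + B 1 * C 1 = 0 := by
  let L := σ.toRealLinearIsometryEquiv
  have hL : ∀ x, σ x = L x + σ 0 := fun x => by
    simp [L, IsometryEquiv.toRealLinearIsometryEquiv_apply]
  let e : Fin 2 → Plane := fun i => EuclideanSpace.single i 1
  have he : ∀ x : Plane, x = x 0 • e 0 + x 1 • e 1 := fun x => by
    ext i; fin_cases i <;> simp [e]
  have hinner : ∀ i j, inner ℝ (L (e i)) (L (e j)) = if i = j then (1 : ℝ) else 0 := fun i j => by
    rw [L.inner_map_map]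
    simp [e, EuclideanSpace.inner_single_left]
  have h00 := hinner 0 0
  have h11 := hinner 1 1
  have h01 := hinner 0 1
  simp only [PiLp.inner_apply, Fin.sum_univ_two, RCLike.inner_apply, conj_trivial] at h00 h11 h01
  refine ⟨fun i => σ 0 i, fun i => L (e 0) i, fun i => L (e 1) i, fun x i => ?_, ?_, ?_, ?_⟩
  · rw [hL x]
    conv_lhs => rw [he x]
    simp only [map_add, map_smul, PiLp.add_apply, PiLp.smul_apply, smul_eq_mul]
    ring
  · simp only [if_true] at h00; linarith
  · simp only [if_true] at h11; linarith
  · simp at h01; linarith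

/-- The closed cell of the square lattice with the given lower left corner. -/
def cell (z : ℤ × ℤ) : Set Plane :=
  {x | x 0 ∈ Set.Icc (z.1 : ℝ) (z.1 + 1) ∧ x 1 ∈ Set.Icc (z.2 : ℝ) (z.2 + 1)}

lemma cell_zero : cell 0 = stdSquare := by
  ext x; simp [cell, stdSquare, Fin.forall_fin_two]

/-- An isometry that fixes the bottom edge of the unit square, and maps the square to one that
meets it just in this edge, maps the square to the cell below it. -/
lemma image_stdSquare_of_inter_eq (κ : Plane ≃ᵢ Plane)
    (h₁ : κ '' {x ∈ stdSquare | x 1 = 0} = {x ∈ stdSquare | x 1 = 0})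
    (h₂ : stdSquare ∩ κ '' stdSquare = {x ∈ stdSquare | x 1 = 0}) :
    κ '' stdSquare = cell (0, -1) := by
  obtain ⟨A, B, C, hκ, hB, hC, hBC⟩ := isometryEquiv_coord κ
  have mem : ∀ x : Plane, x ∈ stdSquare ↔ (0 ≤ x 0 ∧ x 0 ≤ 1) ∧ 0 ≤ x 1 ∧ x 1 ≤ 1 := fun x => by
    simp [stdSquare, Fin.forall_fin_two]
  have hbot : ∀ t : ℝ, 0 ≤ t → t ≤ 1 → 0 ≤ A 0 + B 0 * t ∧ A 0 + B 0 * t ≤ 1 ∧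
      A 1 + B 1 * t = 0 := by
    intro t ht ht'
    have : κ !₂[t, 0] ∈ {x ∈ stdSquare | x 1 = 0} := by
      rw [← h₁]; exact ⟨_, ⟨by simp [mem, ht, ht'], by simp⟩, rfl⟩
    rw [Set.mem_ofPred_eq, mem] at this
    simp only [hκ] at this
    simp at this
    tauto
  have h0 := hbot 0 le_rfl zero_le_one
  have h1 := hbot 1 zero_le_one le_rfl
  have hA1 : A 1 = 0 := by linarith [h0.2.2]
  have hB1 : B 1 = 0 := by linarith [h1.2.2]
  have hB0 : B 0 = 1 ∨ B 0 = -1 := sq_eq_one_iff.1 (by rw [hB1] at hB; linarith)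
  have hC0 : C 0 = 0 := by
    rcases hB0 with h | h <;> rw [h, hB1] at hBC <;> linarith
  have hC1 : C 1 = -1 := by
    rw [hC0] at hC
    rcases sq_eq_one_iff.1 (show C 1 ^ 2 = 1 by linarith) with h | h
    -- With `C 1 = 1` the two squares would also share a point at height 1.
    · exfalso
      have : κ !₂[0, 1] ∈ {x ∈ stdSquare | x 1 = 0} := by
        rw [← h₂]
        refine ⟨?_, _, ?_, rfl⟩
        · rw [mem]
          simp only [hκ]
          simp [hA1, hC0, h]
          constructor <;> linarith [h0.1, h0.2.1]
        · simp [mem]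
      have := this.2
      rw [hκ] at this
      simp [hA1, h] at this
    · exact h
  have hA0 : B 0 = 1 ∧ A 0 = 0 ∨ B 0 = -1 ∧ A 0 = 1 := by
    rcases hB0 with h | h
    · exact Or.inl ⟨h, by linarith [h0.1, h1.2.1]⟩
    · exact Or.inr ⟨h, by linarith [h0.2.1, h1.1]⟩
  ext y
  constructor
  · rintro ⟨x, hx, rfl⟩
    rw [mem] at hx
    simp only [cell, Set.mem_ofPred_eq, Set.mem_Icc, hκ, hA1, hB1, hC0, hC1]
    push_cast
    rcases hA0 with ⟨h, h'⟩ | ⟨h, h'⟩ <;> rw [h, h'] <;>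
      refine ⟨⟨?_, ?_⟩, ?_, ?_⟩ <;> linarith [hx.1.1, hx.1.2, hx.2.1, hx.2.2]
  · intro hy
    simp only [cell, Set.mem_ofPred_eq, Set.mem_Icc] at hy
    push_cast at hy
    obtain ⟨⟨a, b⟩, c, d⟩ := hy
    rcases hA0 with ⟨h, h'⟩ | ⟨h, h'⟩
    · refine ⟨!₂[y 0, -y 1], ?_, ?_⟩
      · rw [mem]; simp; refine ⟨⟨?_, ?_⟩, ?_, ?_⟩ <;> linarith
      · ext i; rw [hκ]; fin_cases i <;> simp [*]
    · refine ⟨!₂[1 - y 0, -y 1], ?_, ?_⟩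
      · rw [mem]; simp; refine ⟨⟨?_, ?_⟩, ?_, ?_⟩ <;> linarith
      · ext i; rw [hκ]; fin_cases i <;> simp [*]

/-- An isometry that maps the unit square to a cell of the lattice maps the cell below the
unit square to a cell of the lattice. -/
lemma exists_image_cell_below (θ : Plane ≃ᵢ Plane) {z : ℤ × ℤ} (h : θ '' stdSquare = cell z) :
    ∃ z', θ '' cell (0, -1) = cell z' := by
  obtain ⟨A, B, C, hθ, hB, hC, hBC⟩ := isometryEquiv_coord θ
  have mem : ∀ x : Plane, x ∈ stdSquare ↔ (0 ≤ x 0 ∧ x 0 ≤ 1) ∧ 0 ≤ x 1 ∧ x 1 ≤ 1 := fun x => by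
    simp [stdSquare, Fin.forall_fin_two]
  have corner : ∀ s t : ℝ, 0 ≤ s → s ≤ 1 → 0 ≤ t → t ≤ 1 →
      (z.1 ≤ A 0 + B 0 * s + C 0 * t ∧ A 0 + B 0 * s + C 0 * t ≤ z.1 + 1) ∧
      z.2 ≤ A 1 + B 1 * s + C 1 * t ∧ A 1 + B 1 * s + C 1 * t ≤ z.2 + 1 := by
    intro s t hs hs' ht ht'
    have : θ !₂[s, t] ∈ cell z := by
      rw [← h]; exact ⟨_, (mem _).2 ⟨⟨hs, hs'⟩, ht, ht'⟩, rfl⟩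
    simpa [cell, hθ] using this
  have h00 := corner 0 0 le_rfl zero_le_one le_rfl zero_le_one
  have h10 := corner 1 0 zero_le_one le_rfl le_rfl zero_le_one
  have h01 := corner 0 1 le_rfl zero_le_one zero_le_one le_rfl
  have h11 := corner 1 1 zero_le_one le_rfl zero_le_one le_rfl
  -- The images of the two diagonals fit in a unit cell, so their coordinates have square at most 1.
  -- By orthonormality each diagonal has squared length 2, so all these squares equal 1, which
  -- forces `C` to be integral.
  have sq_le : ∀ t : ℝ, -1 ≤ t → t ≤ 1 → t ^ 2 ≤ 1 := fun t h h' => by nlinarith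
  have p0 : (B 0 + C 0) ^ 2 ≤ 1 := sq_le _ (by linarith) (by linarith)
  have p1 : (B 1 + C 1) ^ 2 ≤ 1 := sq_le _ (by linarith) (by linarith)
  have m0 : (B 0 - C 0) ^ 2 ≤ 1 := sq_le _ (by linarith) (by linarith)
  have m1 : (B 1 - C 1) ^ 2 ≤ 1 := sq_le _ (by linarith) (by linarith)
  have int : ∀ i, ∃ n : ℤ, C i = n := by
    have key : ∀ b c : ℝ, (b + c) ^ 2 = 1 → (b - c) ^ 2 = 1 → ∃ n : ℤ, c = n := by
      intro b c hp hm
      rcases sq_eq_one_iff.1 hp with hp | hp <;>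
        rcases sq_eq_one_iff.1 hm with hm | hm
      · exact ⟨0, by push_cast; linarith⟩
      · exact ⟨1, by push_cast; linarith⟩
      · exact ⟨-1, by push_cast; linarith⟩
      · exact ⟨0, by push_cast; linarith⟩
    rw [Fin.forall_fin_two]
    exact ⟨key (B 0) (C 0) (by linarith) (by linarith),
      key (B 1) (C 1) (by linarith) (by linarith)⟩
  obtain ⟨c, hc⟩ := int 0
  obtain ⟨d, hd⟩ := int 1
  refine ⟨(z.1 - c, z.2 - d), ?_⟩
  have shift : ∀ x y : Plane, (y 0 = x 0 ∧ y 1 = x 1 + 1) →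
      θ y 0 = θ x 0 + c ∧ θ y 1 = θ x 1 + d := by
    rintro x y ⟨h0, h1⟩
    simp only [hθ, h0, h1, hc, hd]
    constructor <;> ring
  have mem_iff : ∀ y, θ y ∈ cell z ↔ y ∈ stdSquare := fun y => by
    rw [← h]; exact θ.injective.mem_set_image
  ext w
  obtain ⟨x, rfl⟩ := θ.surjective w
  rw [θ.injective.mem_set_image]
  obtain ⟨s0, s1⟩ := shift x !₂[x 0, x 1 + 1] (by simp)
  have := mem_iff !₂[x 0, x 1 + 1]
  rw [mem] at this
  simp only [cell, Set.mem_ofPred_eq, Set.mem_Icc, s0, s1] at this ⊢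
  simp at this
  push_cast
  constructor
  · rintro ⟨⟨a, b⟩, a', b'⟩
    obtain ⟨⟨e, f⟩, e', f'⟩ := this.2 ⟨⟨by linarith, by linarith⟩, by linarith, by linarith⟩
    refine ⟨⟨?_, ?_⟩, ?_, ?_⟩ <;> linarith
  · rintro ⟨⟨a, b⟩, a', b'⟩
    obtain ⟨⟨e, f⟩, e', f'⟩ := this.1 ⟨⟨by linarith, by linarith⟩, by linarith, by linarith⟩
    refine ⟨⟨?_, ?_⟩, ?_, ?_⟩ <;> linarith

/-- Let `ρ` and `τ` carry the unit square to the two squares and its bottom edge to the shared edge.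
Then `ρ⁻¹ ∘ τ` carries the unit square to the cell below it, and `σ⁻¹ ∘ ρ` carries that cell into
the lattice. -/
lemma ShareEdge.exists_cell {σ : Plane ≃ᵢ Plane} {z : ℤ × ℤ} {Q : Set Plane}
    (h : ShareEdge (σ '' cell z) Q) : ∃ z', Q = σ '' cell z' := by
  obtain ⟨⟨ρ, hρ, hρe⟩, τ, rfl, hτe⟩ := h
  have comp : ∀ (α β : Plane ≃ᵢ Plane) (S : Set Plane),
      (α.trans β) '' S = β '' (α '' S) := fun α β S => by
    rw [← Set.image_comp]; rfl
  have cancel : ∀ (α : Plane ≃ᵢ Plane) (S : Set Plane), α.symm '' (α '' S) = S := fun α S => by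
    rw [← Set.image_comp]; simp
  have cancel' : ∀ (α : Plane ≃ᵢ Plane) (S : Set Plane), α '' (α.symm '' S) = S := fun α S => by
    rw [← Set.image_comp]; simp
  have hκ := image_stdSquare_of_inter_eq (τ.trans ρ.symm)
    (by rw [comp, ← hτe, hρe, cancel])
    (by
      rw [comp]
      have hS : stdSquare = ρ.symm '' (σ '' cell z) := by rw [hρ, cancel]
      have hE := congrArg (fun S => ρ.symm '' S) hρe
      simp only [cancel] at hE
      rwa [Set.image_inter ρ.symm.injective, ← hS] at hE)
  obtain ⟨z', hz'⟩ := exists_image_cell_below (ρ.trans σ.symm) (z := z)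
    (by rw [comp, ← hρ, cancel])
  refine ⟨z', ?_⟩
  rw [← hz', ← hκ, comp, cancel', comp, cancel']

/-- Two cells of the square lattice are neighbours if they have an edge in common. -/
def CellNeighbor (p q : ℤ × ℤ) : Prop :=
  p.1 = q.1 ∧ (p.2 = q.2 + 1 ∨ q.2 = p.2 + 1) ∨ p.2 = q.2 ∧ (p.1 = q.1 + 1 ∨ q.1 = p.1 + 1)

lemma CellNeighbor.symm {p q : ℤ × ℤ} (h : CellNeighbor p q) : CellNeighbor q p := by
  unfold CellNeighbor at *; omega

/-- Cells that differ in both coordinates have at most a corner in common. -/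
lemma cellNeighbor_of_mem {z z' : ℤ × ℤ} (hz : z ≠ z') {x y : Plane} (hxy : x ≠ y)
    (hx : x ∈ cell z) (hx' : x ∈ cell z') (hy : y ∈ cell z) (hy' : y ∈ cell z') :
    CellNeighbor z z' := by
  obtain ⟨a, b⟩ := z
  obtain ⟨a', b'⟩ := z'
  simp only [cell, Set.mem_ofPred_eq, Set.mem_Icc] at hx hx' hy hy'
  have close : ∀ {m n : ℤ} {t : ℝ}, (m : ℝ) ≤ t → t ≤ n + 1 → m ≤ n + 1 := fun h h' => by
    exact_mod_cast h.trans h'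
  have a1 := close hx.1.1 hx'.1.2
  have a2 := close hx'.1.1 hx.1.2
  have b1 := close hx.2.1 hx'.2.2
  have b2 := close hx'.2.1 hx.2.2
  have pin : ∀ {m n : ℤ} {s t : ℝ}, m ≠ n → m ≤ n + 1 → n ≤ m + 1 → (m : ℝ) ≤ s ∧ s ≤ m + 1 →
      (n : ℝ) ≤ s ∧ s ≤ n + 1 → (m : ℝ) ≤ t ∧ t ≤ m + 1 → (n : ℝ) ≤ t ∧ t ≤ n + 1 → s = t := by
    intro m n s t hmn h h' hs hs' ht ht'
    have : m = n + 1 ∨ n = m + 1 := by omega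
    rcases this with rfl | rfl <;> push_cast at * <;> linarith
  by_cases ha : a = a'
  · have hb : b ≠ b' := fun hb => hz (by rw [ha, hb])
    simp only [CellNeighbor]
    omega
  · by_cases hb : b = b'
    · simp only [CellNeighbor]
      omega
    · refine absurd ?_ hxy
      ext i
      fin_cases i
      · exact pin ha a1 a2 hx.1 hx'.1 hy.1 hy'.1
      · exact pin hb b1 b2 hx.2 hx'.2 hy.2 hy'.2

/-- The number of cells is too small for a ring around a hole. -/
lemma exists_block (S : Finset (ℤ × ℤ)) (hS : S.Nonempty) (hcard : S.card ≤ 6)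
    (hdeg : ∀ p ∈ S, ∃ q ∈ S, ∃ r ∈ S, q ≠ r ∧ CellNeighbor p q ∧ CellNeighbor p r) :
    ∃ a b, (a, b) ∈ S ∧ (a + 1, b) ∈ S ∧ (a, b + 1) ∈ S ∧ (a + 1, b + 1) ∈ S := by
  by_contra! hno
  have top : ∀ a b : ℤ, (a, b) ∈ S → ∃ y, (a, y) ∈ S ∧ ∀ y', (a, y') ∈ S → y' ≤ y := by
    intro a b hab
    obtain ⟨p, hp, hmax⟩ := (S.filter (fun p => p.1 = a)).exists_max_image Prod.snd
      ⟨(a, b), by simp [hab]⟩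
    rw [Finset.mem_filter] at hp
    obtain ⟨p1, p2⟩ := p
    obtain ⟨hp, rfl⟩ := hp
    exact ⟨p2, hp, fun y' hy' => hmax (p1, y') (by simp [hy'])⟩
  obtain ⟨⟨a, b⟩, hab, hmin⟩ := S.exists_min_image Prod.fst hS
  obtain ⟨⟨c, d⟩, hcd, hmax⟩ := S.exists_max_image Prod.fst hS
  obtain ⟨y, hy, hytop⟩ := top a b hab
  obtain ⟨w, hw, hwtop⟩ := top c d hcd
  -- The top cell of the extreme left column has no neighbour to the left or above, so its two
  -- neighbours are the right and lower ones.
  have left : (a + 1, y) ∈ S ∧ (a, y - 1) ∈ S := by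
    obtain ⟨⟨q1, q2⟩, hq, ⟨r1, r2⟩, hr, hqr, hpq, hpr⟩ := hdeg _ hy
    have := hmin _ hq
    have := hmin _ hr
    grind [CellNeighbor]
  have right : (c - 1, w) ∈ S ∧ (c, w - 1) ∈ S := by
    obtain ⟨⟨q1, q2⟩, hq, ⟨r1, r2⟩, hr, hqr, hpq, hpr⟩ := hdeg _ hw
    have := hmax _ hq
    have := hmax _ hr
    grind [CellNeighbor]
  -- A right neighbour of this second cell would complete a block, so it has one below.
  have left' : (a, y - 1 - 1) ∈ S := by
    have := hno a (y - 1) left.2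
    simp only [sub_add_cancel] at this
    obtain ⟨⟨q1, q2⟩, hq, ⟨r1, r2⟩, hr, hqr, hpq, hpr⟩ := hdeg _ left.2
    have := hmin _ hq
    have := hmin _ hr
    grind [CellNeighbor]
  have right' : (c, w - 1 - 1) ∈ S := by
    have := hno (c - 1) (w - 1)
    simp only [sub_add_cancel] at this
    obtain ⟨⟨q1, q2⟩, hq, ⟨r1, r2⟩, hr, hqr, hpq, hpr⟩ := hdeg _ right.2
    have := hmax _ hq
    have := hmax _ hr
    grind [CellNeighbor]
  have hac := hmax _ left.1
  simp only at hac
  -- If the extreme columns are adjacent, their tops are level and a block appears. Otherwise three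
  -- cells in each column and one in between make seven.
  by_cases hc : c = a + 1
  · subst hc
    have h := right.1
    rw [add_sub_cancel_right] at h
    have : w = y := le_antisymm (hytop _ h) (hwtop _ left.1)
    subst this
    have := hno a (w - 1) left.2 right.2
    simp only [sub_add_cancel] at this
    exact this hy hw
  · let R : Finset (ℤ × ℤ) := {(a, y), (a, y - 1), (a, y - 1 - 1), (a + 1, y),
      (c, w), (c, w - 1), (c, w - 1 - 1)}
    have hR : R ⊆ S := by
      intro p hp
      simp only [R, Finset.mem_insert, Finset.mem_singleton] at hp
      rcases hp with rfl | rfl | rfl | rfl | rfl | rfl | rfl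
      exacts [hy, left.2, left', left.1, hw, right.2, right']
    have hR' : R.card = 7 := by
      have h1 : a ≠ c := by omega
      have h2 : a + 1 ≠ c := by omega
      simp only [R]
      repeat rw [Finset.card_insert_of_notMem (by
        simp only [Finset.mem_insert, Finset.mem_singleton, Prod.mk.injEq]; omega)]
      rw [Finset.card_singleton]
    have := Finset.card_le_card hR
    omega

/-! ### The squares of an unfolding -/

/-- A collection of six squares, indexed by the faces of the cube onto which `f` lays them. -/
lemma FoldsUp.exists_square {𝒬 : Set (Set Plane)} {f : Plane → Space} (h : FoldsUp 𝒬 f) :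
    ∃ sq : CubeFace → Set Plane, (∀ F, sq F ∈ 𝒬) ∧ (∀ F, f '' sq F = F.points) ∧
      ∀ Q ∈ 𝒬, ∃ F, Q = sq F := by
  obtain ⟨-, hmaps, hinj, hsurj⟩ := h
  choose sq hsq himg using fun F : CubeFace => hsurj (isCubeFace_points F)
  refine ⟨sq, hsq, himg, fun Q hQ => ?_⟩
  obtain ⟨F, hF⟩ := (hmaps hQ).exists_points
  exact ⟨F, hinj hQ (hsq F) (hF.trans (himg F).symm)⟩

lemma IsSquare.isClosed {Q : Set Plane} (h : IsSquare Q) : IsClosed Q := by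
  obtain ⟨σ, rfl⟩ := h
  refine σ.toHomeomorph.isClosedMap _ ?_
  rw [stdSquare, Set.ofPred_forall]
  exact isClosed_iInter fun i => isClosed_Icc.preimage (by fun_prop)

lemma IsSquare.nonempty {Q : Set Plane} (h : IsSquare Q) : Q.Nonempty := by
  obtain ⟨σ, rfl⟩ := h
  exact ⟨σ 0, 0, by simp [stdSquare], rfl⟩

/-- Part of the frontier of a disconnected closed set lies on each of its parts. -/
lemma nonempty_frontier_union_inter {X : Type*} [TopologicalSpace X] [PreconnectedSpace X]
    {A B : Set X} (hA : IsClosed A) (hB : IsClosed B) (hA' : A.Nonempty) (hB' : B.Nonempty)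
    (hAB : Disjoint A B) : (frontier (A ∪ B) ∩ A).Nonempty := by
  by_contra hne
  rw [Set.not_nonempty_iff_eq_empty] at hne
  have hsub : A ⊆ interior (A ∪ B) := by
    intro x hx
    by_contra hx'
    have : x ∈ frontier (A ∪ B) ∩ A := ⟨⟨subset_closure (Or.inl hx), hx'⟩, hx⟩
    rw [hne] at this
    exact this
  have heq : A = interior (A ∪ B) ∩ Bᶜ := by
    ext x
    refine ⟨fun hx => ⟨hsub hx, fun hxB => Set.disjoint_left.1 hAB hx hxB⟩, fun hx => ?_⟩
    exact (interior_subset hx.1).resolve_right hx.2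
  have hopen : IsOpen A := by
    rw [heq]; exact isOpen_interior.inter hB.isOpen_compl
  rcases isClopen_iff.1 ⟨hA, hopen⟩ with h | h
  · exact hA'.ne_empty h
  · obtain ⟨x, hx⟩ := hB'
    exact Set.disjoint_left.1 hAB (h ▸ Set.mem_univ x) hx

/-- If the collection is connected then one gets from each square to each other one across
common edges. -/
lemma eq_univ_of_shareEdge {𝒬 : Set (Set Plane)} (hsq : ∀ Q ∈ 𝒬, IsSquare Q)
    (hfin : 𝒬.Finite) (hj : JoinedAlongEdges 𝒬) (hc : IsConnectedCollection 𝒬)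
    {𝒜 : Set (Set Plane)} (h𝒜 : 𝒜 ⊆ 𝒬) (hne : 𝒜.Nonempty)
    (hstep : ∀ Q ∈ 𝒜, ∀ Q' ∈ 𝒬, Q ≠ Q' → ShareEdge Q Q' → Q' ∈ 𝒜) : 𝒜 = 𝒬 := by
  by_contra hneq
  have hB : (𝒬 \ 𝒜).Nonempty := Set.sdiff_nonempty.2 fun h => hneq (h𝒜.antisymm h)
  have closed : ∀ ℬ ⊆ 𝒬, IsClosed (⋃₀ ℬ) := fun ℬ hℬ =>
    Set.sUnion_eq_biUnion ▸
      (hfin.subset hℬ).isClosed_biUnion fun Q hQ => (hsq Q (hℬ hQ)).isClosed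
  have nonempty : ∀ ℬ ⊆ 𝒬, ℬ.Nonempty → (⋃₀ ℬ).Nonempty := fun ℬ hℬ ⟨Q, hQ⟩ =>
    (hsq Q (hℬ hQ)).nonempty.mono (Set.subset_sUnion_of_mem hQ)
  have step : ∀ Q ∈ 𝒜, ∀ Q' ∈ 𝒬, ShareEdge Q Q' → Q' ∈ 𝒜 := fun Q hQ Q' hQ' h => by
    by_cases heq : Q = Q'
    · exact heq ▸ hQ
    · exact hstep Q hQ Q' hQ' heq h
  have disj : Disjoint (⋃₀ 𝒜) (⋃₀ (𝒬 \ 𝒜)) := by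
    rw [Set.disjoint_left]
    rintro x ⟨Q, hQ, hxQ⟩ ⟨Q', ⟨hQ', hnot⟩, hxQ'⟩
    have hne' : Q ≠ Q' := fun h => hnot (h ▸ hQ)
    rcases hj Q (h𝒜 hQ) Q' hQ' hne' ⟨x, hxQ, hxQ'⟩ with h | ⟨p, -, -, -, R, hR, -, h, h'⟩
    · exact hnot (step Q hQ Q' hQ' h)
    · exact hnot (step R (step Q hQ R hR h) Q' hQ' h')
  have cA := closed 𝒜 h𝒜
  have cB := closed (𝒬 \ 𝒜) Set.sdiff_subset
  have nA := nonempty 𝒜 h𝒜 hne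
  have nB := nonempty (𝒬 \ 𝒜) Set.sdiff_subset hB
  have hU : ⋃₀ 𝒬 = ⋃₀ 𝒜 ∪ ⋃₀ (𝒬 \ 𝒜) := by
    rw [← Set.sUnion_union, Set.union_sdiff_cancel h𝒜]
  have hcon := hc.isPreconnected
  rw [hU] at hcon
  -- The frontier is covered by two disjoint closed sets, each of which meets it.
  obtain ⟨x, -, hx, hx'⟩ := isPreconnected_closed_iff.1 hcon _ _ cA cB
    (cA.union cB).frontier_subset
    (nonempty_frontier_union_inter cA cB nA nB disj)
    (by
      rw [Set.union_comm]
      exact nonempty_frontier_union_inter cB cA nB nA disj.symm)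
  exact Set.disjoint_left.1 disj hx hx'

lemma IsUncut.symm {𝒬 : Set (Set Plane)} {f : Plane → Space} {u v : CubeVertex}
    (h : IsUncut 𝒬 f u v) : IsUncut 𝒬 f v u := by
  unfold IsUncut at *
  rwa [cubeEdge, segment_symm]

lemma mem_points_of_mem_cubeEdge {F G : CubeFace} (hFG : F.1 ≠ G.1) {x : Space}
    (hx : x ∈ cubeEdge (edgeStart F G) (edgeStart G F)) : x ∈ F.points ∧ x ∈ G.points := by
  have convex : ∀ H : CubeFace, Convex ℝ H.points := fun H => by
    refine Convex.inter (s := {x : Space | ∀ j, x j ∈ Set.Icc (0 : ℝ) 1}) ?_ ?_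
    · rw [Set.ofPred_forall]
      exact convex_iInter fun i =>
        (convex_Icc (0 : ℝ) 1).linear_preimage (EuclideanSpace.proj i).toLinearMap
    · exact (convex_singleton (if H.2 then (1 : ℝ) else 0)).linear_preimage
        (EuclideanSpace.proj H.1).toLinearMap
  constructor
  · refine (convex F).segment_subset ?_ ?_ hx <;> rw [vertexPos_mem_points] <;>
      simp [edgeStart, hFG]
  · refine (convex G).segment_subset ?_ ?_ hx <;> rw [vertexPos_mem_points] <;>
      simp [edgeStart, hFG.symm]

lemma exists_third {i j : Fin 3} (h : i ≠ j) : ∃ k, ∀ l : Fin 3, l = i ∨ l = j ∨ l = k := by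
  revert i j; decide

/-- Points of the common edge of two faces are as far apart as their remaining coordinates. -/
lemma dist_eq_of_mem_points {F G : CubeFace} {k : Fin 3}
    (hk : ∀ l : Fin 3, l = F.1 ∨ l = G.1 ∨ l = k) {x y : Space} (hx : x ∈ F.points)
    (hx' : x ∈ G.points) (hy : y ∈ F.points) (hy' : y ∈ G.points) :
    dist x y = |x k - y k| := by
  have h : x - y = EuclideanSpace.single k (x k - y k) := by
    ext l
    by_cases hl : l = k
    · subst hl; simp
    · have : x l = y l := by
        rcases hk l with rfl | rfl | rfl
        · exact hx.2.trans hy.2.symm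
        · exact hx'.2.trans hy'.2.symm
        · exact absurd rfl hl
      simp [hl, this]
  rw [dist_eq_norm, h, PiLp.norm_single, Real.norm_eq_abs]

/-- Squares that share an edge remain attached along an edge of the cube. -/
lemma FoldsUp.isUncut_of_shareEdge {𝒬 : Set (Set Plane)} {f : Plane → Space} (h : FoldsUp 𝒬 f)
    {Q Q' : Set Plane} (hQ : Q ∈ 𝒬) (hQ' : Q' ∈ 𝒬) {F G : CubeFace} (hF : f '' Q = F.points)
    (hG : f '' Q' = G.points) (hFG : F ≠ G) (hs : ShareEdge Q Q') :
    F.1 ≠ G.1 ∧ IsUncut 𝒬 f (edgeStart F G) (edgeStart G F) := by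
  obtain ⟨⟨σ, -, hσ⟩, -⟩ := hs
  have hmem : ∀ t : ℝ, 0 ≤ t → t ≤ 1 → σ !₂[t, 0] ∈ Q ∩ Q' := fun t h0 h1 => by
    rw [hσ]
    exact ⟨_, by simp [stdSquare, Fin.forall_fin_two, h0, h1], rfl⟩
  have hfF : ∀ x ∈ Q ∩ Q', f x ∈ F.points := fun x hx => hF ▸ ⟨x, hx.1, rfl⟩
  have hfG : ∀ x ∈ Q ∩ Q', f x ∈ G.points := fun x hx => hG ▸ ⟨x, hx.2, rfl⟩
  have m0 := hmem 0 le_rfl zero_le_one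
  have m1 := hmem 1 zero_le_one le_rfl
  have hne := fst_ne_of_mem_points hFG (hfF _ m0) (hfG _ m0)
  refine ⟨hne, Q, hQ, Q', hQ', fun hQQ => hFG (points_injective (by rw [← hF, hQQ, hG])), ?_⟩
  obtain ⟨k, hk⟩ := exists_third hne
  have hd : ∀ s t : ℝ, 0 ≤ s → s ≤ 1 → 0 ≤ t → t ≤ 1 →
      |f (σ !₂[s, 0]) k - f (σ !₂[t, 0]) k| = |s - t| := by
    intro s t hs hs' ht ht'
    have ms := hmem s hs hs'
    have mt := hmem t ht ht'
    rw [← dist_eq_of_mem_points hk (hfF _ ms) (hfG _ ms) (hfF _ mt) (hfG _ mt),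
      h.1 Q hQ _ ms.1 _ mt.1, σ.dist_eq, EuclideanSpace.dist_eq, Fin.sum_univ_two]
    simp [Real.dist_eq, Real.sqrt_sq_eq_abs]
  intro x hx
  obtain ⟨hxF, hxG⟩ := mem_points_of_mem_cubeEdge hne hx
  have finish : ∀ t : ℝ, 0 ≤ t → t ≤ 1 → f (σ !₂[t, 0]) k = x k → x ∈ f '' (Q ∩ Q') := by
    intro t h0 h1 ht
    have mt := hmem t h0 h1
    refine ⟨_, mt, ?_⟩
    rw [← dist_eq_zero, dist_eq_of_mem_points hk (hfF _ mt) (hfG _ mt) hxF hxG, ht, sub_self,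
      abs_zero]
  have b0 := (hfF _ m0).1 k
  have b1 := (hfF _ m1).1 k
  have bx := hxF.1 k
  rw [Set.mem_Icc] at b0 b1 bx
  have d01 := hd 0 1 le_rfl zero_le_one zero_le_one le_rfl
  rw [zero_sub, abs_neg, abs_one] at d01
  -- Along the shared edge, coordinate `k` of `f` is an isometry of `[0,1]` into itself, so it is `1
  -- - t` or `t`; either way it takes the value `x k`.
  rcases (abs_eq zero_le_one).1 d01 with e | e
  · have d := hd (1 - x k) 1 (by linarith) (by linarith) zero_le_one le_rfl
    have bt := (hfF _ (hmem (1 - x k) (by linarith) (by linarith))).1 k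
    refine finish (1 - x k) (by linarith) (by linarith) ?_
    rw [abs_of_nonneg (by linarith [bt.1]), abs_of_nonpos (by linarith)] at d
    linarith
  · have d := hd (x k) 0 bx.1 bx.2 le_rfl zero_le_one
    have bt := (hfF _ (hmem (x k) bx.1 bx.2)).1 k
    refine finish (x k) bx.1 bx.2 ?_
    rw [abs_of_nonneg (by linarith [bt.1]), abs_of_nonneg (by linarith)] at d
    linarith

/-! ### The dual graph -/

/-- The graph on the faces of the cube in which two faces are adjacent when the unfolding leaves
them attached along their common edge. -/
def dualGraph (𝒬 : Set (Set Plane)) (f : Plane → Space) : SimpleGraph CubeFace where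
  Adj F G := F.1 ≠ G.1 ∧ IsUncut 𝒬 f (edgeStart F G) (edgeStart G F)
  symm := ⟨fun _ _ h => ⟨h.1.symm, h.2.symm⟩⟩
  loopless := ⟨fun _ h => h.1 rfl⟩

/-- The dual graph of an unfolding is connected. The squares are cells of a square lattice;
squares that remain attached are neighbours, and no four of the squares have a point in common. -/
lemma IsUnfolding.exists_lattice {𝒬 : Set (Set Plane)} {f : Plane → Space}
    (h : IsUnfolding 𝒬 f) : (dualGraph 𝒬 f).Connected ∧ ∃ z : CubeFace → ℤ × ℤ,
      (∀ F G, (dualGraph 𝒬 f).Adj F G → CellNeighbor (z F) (z G)) ∧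
      Function.Injective z ∧ ¬ ∃ a b F G H K, z F = (a, b) ∧ z G = (a + 1, b) ∧
        z H = (a, b + 1) ∧ z K = (a + 1, b + 1) := by
  obtain ⟨sq, hsq, himg, hall⟩ := h.folds.exists_square
  have hfin : 𝒬.Finite := Set.finite_of_ncard_pos (by rw [h.six]; norm_num)
  have sq_inj : Function.Injective sq := fun F G hFG =>
    points_injective (by rw [← himg, ← himg, hFG])
  refine ⟨⟨fun F G => ?_⟩, ?_⟩
  · have := eq_univ_of_shareEdge h.isSquare hfin h.joined h.connected
      (𝒜 := {Q | ∃ H, Q = sq H ∧ (dualGraph 𝒬 f).Reachable F H})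
      (by rintro _ ⟨H, rfl, -⟩; exact hsq H) ⟨_, F, rfl, SimpleGraph.Reachable.refl F⟩
      (by
        rintro _ ⟨H, rfl, hH⟩ Q' hQ' hne hs
        obtain ⟨K, rfl⟩ := hall Q' hQ'
        refine ⟨K, rfl, hH.trans (SimpleGraph.Adj.reachable ?_)⟩
        exact h.folds.isUncut_of_shareEdge (hsq H) (hsq K) (himg H) (himg K)
          (fun e => hne (by rw [e])) hs)
    have hG := hsq G
    rw [← this] at hG
    obtain ⟨H, hH, hr⟩ := hG
    rwa [sq_inj hH]
  -- One square fixes the lattice, and lattice position spreads across shared edges.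
  obtain ⟨σ, hσ⟩ := h.isSquare _ (hsq (0, false))
  have hlat := eq_univ_of_shareEdge h.isSquare hfin h.joined h.connected
    (𝒜 := {Q | Q ∈ 𝒬 ∧ ∃ z, Q = σ '' cell z})
    (fun Q hQ => hQ.1) ⟨_, hsq (0, false), 0, by rw [cell_zero, hσ]⟩
    (by
      rintro _ ⟨-, z, rfl⟩ Q' hQ' - hs
      exact ⟨hQ', hs.exists_cell⟩)
  have hz : ∀ F, ∃ z, sq F = σ '' cell z := fun F => by
    have := hsq F
    rw [← hlat] at this
    exact this.2
  choose z hz using hz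
  have z_inj : Function.Injective z := fun F G hFG => sq_inj (by rw [hz, hz, hFG])
  refine ⟨z, ?_, z_inj, ?_⟩
  · rintro F G ⟨hFG, Q, hQ, Q', hQ', hne, hsub⟩
    obtain ⟨H, rfl⟩ := hall Q hQ
    obtain ⟨K, rfl⟩ := hall Q' hQ'
    obtain ⟨x, hx, hfx⟩ := hsub (left_mem_segment ℝ _ _)
    obtain ⟨y, hy, hfy⟩ := hsub (right_mem_segment ℝ _ _)
    have face : ∀ L, x ∈ sq L → y ∈ sq L → L = F ∨ L = G := fun L hxL hyL => by
      refine eq_or_eq_of_edgeStart hFG ?_ ?_ <;> rw [← vertexPos_mem_points, ← himg L]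
      · exact ⟨x, hxL, hfx⟩
      · exact ⟨y, hyL, hfy⟩
    have hxy : x ≠ y := by
      rintro rfl
      have hF : ∀ (k : Fin 3), vertexPos (edgeStart F G) k = vertexPos (edgeStart G F) k := by
        intro k; rw [← hfx, ← hfy]
      refine (cubeGraph_adj_edgeStart hFG).ne (funext fun k => ?_)
      have := hF k
      simp only [vertexPos] at this
      cases h1 : edgeStart F G k <;> cases h2 : edgeStart G F k <;> simp [h1, h2] at this ⊢
    have hHK : CellNeighbor (z H) (z K) := by
      rw [hz H, hz K, ← Set.image_inter σ.injective] at hx hy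
      obtain ⟨x', hx', rfl⟩ := hx
      obtain ⟨y', hy', rfl⟩ := hy
      exact cellNeighbor_of_mem (fun e => hne (by rw [hz, hz, e])) (fun e => hxy (by rw [e]))
        hx'.1 hx'.2 hy'.1 hy'.2
    rcases face H hx.1 hy.1 with rfl | rfl <;> rcases face K hx.2 hy.2 with rfl | rfl
    · exact absurd rfl hne
    · exact hHK
    · exact hHK.symm
    · exact absurd rfl hne
  · rintro ⟨a, b, F, G, H, K, hF, hG, hH, hK⟩
    have hp : ∀ L, (z L).1 = a ∨ (z L).1 = a + 1 → (z L).2 = b ∨ (z L).2 = b + 1 →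
        f (σ !₂[(a : ℝ) + 1, (b : ℝ) + 1]) ∈ L.points := by
      intro L h1 h2
      rw [← himg L, hz L]
      refine ⟨_, ⟨_, ?_, rfl⟩, rfl⟩
      rcases h1 with h1 | h1 <;> rcases h2 with h2 | h2 <;> simp [cell, h1, h2]
    have ne : ∀ {L M}, z L ≠ z M → L ≠ M := fun h e => h (by rw [e])
    have pF := hp F (by simp [hF]) (by simp [hF])
    have pG := hp G (by simp [hG]) (by simp [hG])
    have pH := hp H (by simp [hH]) (by simp [hH])
    have pK := hp K (by simp [hK]) (by simp [hK])
    have h1 := fst_ne_of_mem_points (ne (by simp [hF, hG])) pF pG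
    have h2 := fst_ne_of_mem_points (ne (by simp [hF, hH])) pF pH
    have h3 := fst_ne_of_mem_points (ne (by simp [hF, hK])) pF pK
    have h4 := fst_ne_of_mem_points (ne (by simp [hG, hH])) pG pH
    have h5 := fst_ne_of_mem_points (ne (by simp [hG, hK])) pG pK
    have h6 := fst_ne_of_mem_points (ne (by simp [hH, hK])) pH pK
    omega

/-! ### Spanning trees -/

/-- If all the edges between a set of vertices and its complement are uncut, the set is trivial. -/
lemma IsUnfolding.exists_cut_edge {𝒬 : Set (Set Plane)} {f : Plane → Space}
    (h : IsUnfolding 𝒬 f) (A : Set CubeVertex) {u w : CubeVertex} (hu : u ∈ A) (hw : w ∉ A) :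
    ∃ x ∈ A, ∃ y ∉ A, cubeGraph.Adj x y ∧ ¬ IsUncut 𝒬 f x y := by
  classical
  by_contra! hno
  obtain ⟨-, z, hadj, z_inj, hblock⟩ := h.exists_lattice
  let Crossing (F G : CubeFace) : Prop :=
    F.1 ≠ G.1 ∧ ¬ (edgeStart F G ∈ A ↔ edgeStart G F ∈ A)
  have hcross : ∀ F G, Crossing F G → CellNeighbor (z F) (z G) ∧ z F ≠ z G := by
    rintro F G ⟨hFG, hc⟩
    have hN : CellNeighbor (z F) (z G) := by
      refine hadj F G ⟨hFG, ?_⟩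
      by_cases hF : edgeStart F G ∈ A
      · exact hno _ hF _ (fun hG => hc (by simp [hF, hG])) (cubeGraph_adj_edgeStart hFG)
      · exact (hno _ (by tauto) _ hF (cubeGraph_adj_edgeStart hFG).symm).symm
    refine ⟨hN, fun e => ?_⟩
    rw [e] at hN
    simp only [CellNeighbor] at hN
    omega
  have hsymm : ∀ F G, Crossing F G → Crossing G F := fun F G hc => ⟨hc.1.symm, by tauto⟩
  let S : Finset (ℤ × ℤ) := (Finset.univ.filter fun F => ∃ G, Crossing F G).image z
  have memS : ∀ p, p ∈ S ↔ ∃ F, (∃ G, Crossing F G) ∧ z F = p := fun p => by simp [S]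
  have hS : S.Nonempty := by
    obtain ⟨p⟩ := cubeGraph_preconnected u w
    obtain ⟨d, -, hd, hd'⟩ := p.exists_boundary_dart A hu hw
    obtain ⟨F, G, hFG, h1, h2⟩ := exists_edgeStart_eq d.adj
    refine ⟨z F, (memS _).2 ⟨F, ⟨G, hFG, ?_⟩, rfl⟩⟩
    rw [← h1, ← h2]
    tauto
  have hcard : S.card ≤ 6 :=
    Finset.card_image_le.trans ((Finset.card_filter_le _ _).trans (by simp))
  obtain ⟨a, b, h1, h2, h3, h4⟩ := exists_block S hS hcard (by
    intro p hp
    obtain ⟨F, ⟨G, hFG, hc⟩, rfl⟩ := (memS p).1 hp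
    -- Going round `F`, membership in `A` cannot change exactly once.
    have : ∃ G', G' ≠ G ∧ Crossing F G' := by
      obtain ⟨G₁, G₂, G₃, ⟨n1, n2, n3⟩, ⟨f1, f2, f3⟩, e0, e1, e2, e3⟩ := exists_circuit hFG
      by_contra! hall
      have c1 := hall G₁ n1
      have c2 := hall G₂ n2
      have c3 := hall G₃ n3
      simp only [Crossing, f1, f2, f3, e1, e2, e3, ← e0, ne_eq, not_false_eq_true, true_and,
        not_not] at c1 c2 c3
      tauto
    obtain ⟨G', hne, hc'⟩ := this
    have hG := hcross F G ⟨hFG, hc⟩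
    have hG' := hcross F G' hc'
    refine ⟨z G, (memS _).2 ⟨G, ⟨F, hsymm _ _ ⟨hFG, hc⟩⟩, rfl⟩, z G',
      (memS _).2 ⟨G', ⟨F, hsymm _ _ hc'⟩, rfl⟩, ?_, hG.1, hG'.1⟩
    exact fun e => hne (z_inj e).symm)
  obtain ⟨F, -, hF⟩ := (memS _).1 h1
  obtain ⟨G, -, hG⟩ := (memS _).1 h2
  obtain ⟨H, -, hH⟩ := (memS _).1 h3
  obtain ⟨K, -, hK⟩ := (memS _).1 h4
  exact hblock ⟨a, b, F, G, H, K, hF, hG, hH, hK⟩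

/-- Each of the twelve edges counts once in each direction. -/
lemma card_cubeGraph_darts :
    Fintype.card {p : CubeVertex × CubeVertex // hammingDist p.1 p.2 = 1} = 24 := by
  decide

/-- An unfolding leaves so many edges uncut that the remaining ones are the edges of a tree. -/
lemma IsUnfolding.isTree {𝒬 : Set (Set Plane)} {f : Plane → Space} (h : IsUnfolding 𝒬 f)
    {T : SimpleGraph CubeVertex}
    (hT : ∀ u v, T.Adj u v ↔ cubeGraph.Adj u v ∧ ¬ IsUncut 𝒬 f u v) : T.IsTree := by
  classical
  have hconn : T.Connected := ⟨fun u w => by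
    by_contra hnot
    obtain ⟨x, hx, y, hy, hadj⟩ := h.exists_cut_edge {x | T.Reachable u x} (u := u)
      (SimpleGraph.Reachable.refl u) hnot
    exact hy (SimpleGraph.Reachable.trans hx ((hT x y).2 hadj).reachable)⟩
  have hdual := h.exists_lattice.1
  let D := dualGraph 𝒬 f
  -- Darts of the dual graph go to oriented uncut edges and darts of `T` to oriented cut ones, so
  -- injectivity bounds the two edge counts together by twelve.
  let toCube : D.Dart ⊕ T.Dart → {p : CubeVertex × CubeVertex // hammingDist p.1 p.2 = 1} :=
    Sum.elim
      (fun d => ⟨(edgeStart d.fst d.snd, edgeStart d.snd d.fst), cubeGraph_adj_edgeStart d.adj.1⟩)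
      (fun d => ⟨(d.fst, d.snd), ((hT _ _).1 d.adj).1⟩)
  have hinj : Function.Injective toCube := by
    have mixed : ∀ (d : D.Dart) (e : T.Dart), toCube (Sum.inl d) ≠ toCube (Sum.inr e) := by
      intro d e hde
      replace hde := Prod.ext_iff.1 (congrArg Subtype.val hde)
      dsimp only [toCube, Sum.elim_inl, Sum.elim_inr] at hde
      refine ((hT _ _).1 e.adj).2 ?_
      rw [← hde.1, ← hde.2]
      exact d.adj.2
    rintro (d | d) (e | e) hde
    · replace hde := Prod.ext_iff.1 (congrArg Subtype.val hde)
      have := edgeStart_injective d.adj.1 e.adj.1 hde.1 hde.2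
      exact congrArg _ (SimpleGraph.Dart.ext _ _ (Prod.ext this.1 this.2))
    · exact absurd hde (mixed d e)
    · exact absurd hde.symm (mixed e d)
    · replace hde := Prod.ext_iff.1 (congrArg Subtype.val hde)
      exact congrArg _ (SimpleGraph.Dart.ext _ _ (Prod.ext hde.1 hde.2))
  have hcard := Fintype.card_le_of_injective toCube hinj
  rw [card_cubeGraph_darts, Fintype.card_sum, SimpleGraph.dart_card_eq_twice_card_edges,
    SimpleGraph.dart_card_eq_twice_card_edges] at hcard
  have hD := SimpleGraph.Connected.card_vert_le_card_edgeSet_add_one (G := D) hdual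
  have hT' := hconn.card_vert_le_card_edgeSet_add_one
  rw [SimpleGraph.isTree_iff_connected_and_card]
  refine ⟨hconn, ?_⟩
  simp only [Nat.card_eq_fintype_card, ← SimpleGraph.edgeFinset_card] at hD hT' ⊢
  have c6 : Fintype.card CubeFace = 6 := by simp
  have c8 : Fintype.card CubeVertex = 8 := by simp
  omega

end CubeUnfolding

theorem mainTheorem8 (T : CubeUnfolding.cubeGraph.Subgraph)
    (hT : CubeUnfolding.ProducesUnfolding T) :
    CubeUnfolding.IsSpanningTree T := by
  obtain ⟨𝒬, f, hU, hadj⟩ := hT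
  have htree := hU.isTree (T := T.spanningCoe) hadj
  -- A connected graph on eight vertices has no isolated vertex, so every vertex is an end of an
  -- edge of `T`.
  have hspan : T.IsSpanning := fun v => by
    obtain ⟨w, hw⟩ := htree.1.preconnected.exists_adj_of_nontrivial v
    exact T.edge_vert hw
  refine ⟨hspan, ?_, ?_⟩
  · rw [T.connected_iff']
    exact (T.spanningCoeEquivCoeOfSpanning hspan).connected_iff.1 htree.1
  · exact htree.2.comap ⟨Subtype.val, fun h => h⟩ Subtype.val_injective
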